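/- **Conventions.** A looped graph is a finite graph without multiple edges in which vertices may carry loops; graphs are considered up to isomorphism. Let $D$ be a plane diagram of a classical or virtual knot (one component; crossings are classical or virtual). Its looped interlacement graph $\mathcal{L}(D)$ has one vertex for each classical crossing of $D$; two distinct vertices are adjacent iff the corresponding crossings are interlaced, i.e. while tracing $D$ one meets first one crossing, then the other, then the first again, and finally the second again; and there is a loop at each vertex that corresponds to a negative crossing. Two looped graphs are Reidemeister equivalent if one can be obtained from the other by a finite sequence of the following moves. $\Omega.1$: adjoin or remove an isolated vertex, looped or unlooped. $\Omega.2$: adjoin or remove two vertices $v,w$, with $v$ looped and $w$ unlooped, such that every vertex $x\notin\{v,w\}$ adjacent to one of $v,w$ is adjacent to the other ($v$ and $w$ may or may not be adjacent). $\Omega.3$: toggle the non-loop adjacencies among three distinct vertices $u,v,w$, provided that every vertex $x\notin\{u,v,w\}$ adjacent to any of $u,v,w$ is adjacent to precisely two of them, and that before or after the move the subgraph spanned by $u,v,w$ is one of the following six: a three-vertex path with (a) all vertices looped, (b) no vertex looped, (c) the centre and precisely one end looped, (d) precisely one end looped and no other vertex looped; or a triangle with (e) precisely two vertices looped, (f)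 precisely one vertex looped. Two classical diagrams are diagrams of the same classical knot if they are related by a finite sequence of Reidemeister moves through classical diagrams; two diagrams are diagrams of the same virtual knot if they are related by a finite sequence of Reidemeister moves and of the additional moves for virtual crossings. (Diagrams are considered up to isotopy, and knots are unoriented.) **Theorem.** If $D_1$ and $D_2$ are diagrams of the same classical knot, or of the same virtual knot, then $\mathcal{L}(D_1)$ and $\mathcal{L}(D_2)$ are Reidemeister equivalent. Hence there is a unique map $\widetilde{\mathcal{L}}$ from classical knots, and a unique map $\widetilde{\mathcal{L}}$ from virtual knots, to looped graphs modulo Reidemeister equivalence that sends the knot represented by a diagram $D$ to the class of $\mathcal{L}(D)$. -/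

import Mathlib

/-! ### Looped graphs and graph Reidemeister equivalence -/

/-- A finite graph without multiple edges in which a vertex may carry a loop: a simple graph that
records the non-loop edges, together with the set of looped vertices. -/
structure LoopedGraph where
  V : Type
  finite : Finite V
  graph : SimpleGraph V
  loops : Set V

namespace LoopedGraph

/-- Isomorphism of looped graphs. -/
def Isomorphic (G H : LoopedGraph) : Prop :=
  ∃ f : G.graph ≃g H.graph, ∀ x, f x ∈ H.loops ↔ x ∈ G.loops

/-- The graph obtained by removing the vertices in `S` and all edges incident on them. -/
def delete (G : LoopedGraph) (S : Set G.V) : LoopedGraph where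
  V := {x : G.V // x ∉ S}
  finite := haveI := G.finite; inferInstance
  graph := G.graph.comap Subtype.val
  loops := Subtype.val ⁻¹' G.loops

/-- The graph obtained by toggling the non-loop adjacencies among the vertices in `S`. -/
def toggle (G : LoopedGraph) (S : Set G.V) : LoopedGraph where
  V := G.V
  finite := G.finite
  graph :=
    { Adj := fun x y => x ≠ y ∧ Xor (G.graph.Adj x y) (x ∈ S ∧ y ∈ S)
      symm := ⟨fun x y h => ⟨h.1.symm, by
        have h2 := h.2
        rw [G.graph.adj_comm, and_comm (a := x ∈ S)] at h2
        exact h2⟩⟩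
      loopless := ⟨fun _ h => h.1 rfl⟩ }
  loops := G.loops

/-- The six three-vertex configurations of the third Reidemeister move, on vertices named `u`, `v`,
`w`. Either the three vertices span a path `v - u - w` with
all three vertices looped; no vertex looped; the centre `u` and precisely one end `v` looped;
or precisely one end `v` looped and no other vertex looped;
or they span a triangle with precisely two vertices `u`, `v` or precisely one vertex `u` looped. -/
def IsTriangleConfiguration (G : LoopedGraph) (u v w : G.V) : Prop :=
  (G.graph.Adj u v ∧ G.graph.Adj u w ∧ ¬ G.graph.Adj v w ∧
    ((u ∈ G.loops ∧ v ∈ G.loops ∧ w ∈ G.loops) ∨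
     (u ∉ G.loops ∧ v ∉ G.loops ∧ w ∉ G.loops) ∨
     (u ∈ G.loops ∧ v ∈ G.loops ∧ w ∉ G.loops) ∨
     (u ∉ G.loops ∧ v ∈ G.loops ∧ w ∉ G.loops))) ∨
  (G.graph.Adj u v ∧ G.graph.Adj u w ∧ G.graph.Adj v w ∧
    ((u ∈ G.loops ∧ v ∈ G.loops ∧ w ∉ G.loops) ∨
     (u ∈ G.loops ∧ v ∉ G.loops ∧ w ∉ G.loops)))

/-- The graph Reidemeister moves (graphs being considered up to isomorphism). The moves `omega1` and
`omega2` are written as removals; adjoining vertices is the inverse relation. -/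
inductive Move : LoopedGraph → LoopedGraph → Prop
  | iso {G H : LoopedGraph} (h : G.Isomorphic H) : Move G H
  /-- Remove an isolated vertex, looped or not. -/
  | omega1 (G : LoopedGraph) (v : G.V) (hv : ∀ x, ¬ G.graph.Adj v x) : Move G (G.delete {v})
  /-- Remove a looped vertex `v` and an unlooped vertex `w` with the same neighbours outside
  `{v, w}`. -/
  | omega2 (G : LoopedGraph) (v w : G.V) (hv : v ∈ G.loops) (hw : w ∉ G.loops)
      (h : ∀ x, x ≠ v → x ≠ w → (G.graph.Adj x v ↔ G.graph.Adj x w)) : Move G (G.delete {v, w})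
  /-- Toggle the non-loop adjacencies among distinct `u`, `v`, `w`, if every other vertex is
  adjacent to none or to precisely two of them and they span one of the six
  configurations before or after the move. -/
  | omega3 (G : LoopedGraph) (u v w : G.V) (huv : u ≠ v) (huw : u ≠ w) (hvw : v ≠ w)
      (h : ∀ x, x ≠ u → x ≠ v → x ≠ w →
        (¬ G.graph.Adj x u ∧ ¬ G.graph.Adj x v ∧ ¬ G.graph.Adj x w) ∨
        (¬ G.graph.Adj x u ∧ G.graph.Adj x v ∧ G.graph.Adj x w) ∨
        (G.graph.Adj x u ∧ ¬ G.graph.Adj x v ∧ G.graph.Adj x w) ∨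
        (G.graph.Adj x u ∧ G.graph.Adj x v ∧ ¬ G.graph.Adj x w))
      (hc : G.IsTriangleConfiguration u v w ∨
        (G.toggle {u, v, w}).IsTriangleConfiguration u v w) :
      Move G (G.toggle {u, v, w})

/-- Reidemeister equivalence of looped graphs: a finite sequence of moves and inverse moves. -/
def reidemeisterSetoid : Setoid LoopedGraph := Relation.EqvGen.setoid Move

/-- Two looped graphs are Reidemeister equivalent. -/
def ReidemeisterEquivalent (G H : LoopedGraph) : Prop := Relation.EqvGen Move G H

/-- Looped graphs modulo Reidemeister equivalence. -/
abbrev ReidemeisterClass : Type 1 := Quotient reidemeisterSetoid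

end LoopedGraph

/-! ### Plane diagrams of classical and virtual knots -/

/-- A letter `(x, b)` stands for one of the two passages of the curve through the crossing `x`. At a
classical crossing `(x, true)` is the overpass and `(x, false)` the underpass; at a virtual
crossing the two passages are told apart arbitrarily. -/
abbrev Passage : Type := ℕ × Bool

/-- A directed edge of a diagram: `(p, 1)` is the edge that ends in the passage `p`, traversed along
the orientation of the curve, and `(p, -1)` is the edge that starts in the passage `p`, traversed
against the orientation. In both cases one arrives at the crossing through `p`. -/
abbrev Dart : Type := Passage × ℤˣ

/-- Walking around a face of the diagram, with the face on the left-hand side: arriving at a crossing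
along `d`, one turns left into the other strand, and goes on to the next crossing. Here `sign x`
is `1` iff the directions of the passages `(x, true)`, `(x, false)` form a positive basis of the
plane. -/
def faceStep (word : List Passage) (sign : ℕ → ℤˣ) (d : Dart) : Dart :=
  let x := d.1.1
  let b := d.1.2
  if sign x * (if b then 1 else -1) * d.2 = 1 then
    (word.formPerm (x, !b), 1)
  else
    (word.formPerm⁻¹ (x, !b), -1)

/-- All directed edges of the diagram: two for each passage. -/
def dartFinset (word : List Passage) : Finset Dart := word.toFinset ×ˢ {1, -1}

/-- The number of faces: the number of orbits of `faceStep` on the directed edges, an orbit being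
represented by the set of its elements (there are twice as many directed edges as passages). -/
def faceCount (word : List Passage) (sign : ℕ → ℤˣ) : ℕ :=
  ((dartFinset word).image fun d =>
    (Finset.range (2 * word.length)).image fun k => (faceStep word sign)^[k] d).card

/-- The closed curve with crossings given by `word` and `sign` lies in the plane (equivalently, on
the sphere): the surface obtained by gluing a disc to each face has Euler characteristic
`V - E + F = 2`, where `V` is half of the length of the word and `E` is its length. The curve
without crossings is a circle in the plane. -/
def IsPlanar (word : List Passage) (sign : ℕ → ℤˣ) : Prop :=
  word = [] ∨ 2 * faceCount word sign = word.length + 4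

/-- A plane diagram of a classical or virtual knot, up to isotopy, with an orientation and a
base point (both are forgotten by the equivalences below): the passages through crossings,
classical and virtual, in the order in which they are met while tracing the curve; the type of each
crossing; and the sign of each crossing. At a classical crossing this is the usual sign: the
directions of the overpass and the underpass form a positive basis iff the sign is `1`.
The values of `isVirtual` and `sign` at numbers that are not crossings are irrelevant. -/
structure KnotDiagram where
  word : List Passage
  isVirtual : ℕ → Prop
  sign : ℕ → ℤˣ
  nodup : word.Nodup
  twice : ∀ x b, (x, b) ∈ word → (x, !b) ∈ word
  planar : IsPlanar word sign

namespace KnotDiagram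

/-- `x` is a crossing of `D`, classical or virtual. -/
def IsCrossing (D : KnotDiagram) (x : ℕ) : Prop := (x, true) ∈ D.word

/-- A diagram is classical if it has no virtual crossings. -/
def IsClassical (D : KnotDiagram) : Prop := ∀ x, D.IsCrossing x → ¬ D.isVirtual x

/-- Tracing the curve from the base point one meets the distinct crossings `x` and `y` alternately:
first one, then the other, then the first again, and finally the second again. -/
def Interlaced (D : KnotDiagram) (x y : ℕ) : Prop :=
  x ≠ y ∧ ∃ a b : Bool,
    List.Sublist [(x, a), (y, b), (x, !a), (y, !b)] D.word ∨
    List.Sublist [(y, b), (x, a), (y, !b), (x, !a)] D.word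

/-- The looped interlacement graph: the vertices are the classical crossings, two
distinct vertices are adjacent iff the crossings are interlaced, and the looped vertices are the
negative crossings. -/
def loopedInterlacementGraph (D : KnotDiagram) : LoopedGraph where
  V := {x : ℕ // D.IsCrossing x ∧ ¬ D.isVirtual x}
  finite := by
    refine Set.Finite.subset (D.word.map Prod.fst).finite_toSet (s := _) ?_ |>.to_subtype
    intro x hx
    exact List.mem_map.2 ⟨(x, true), hx.1, rfl⟩
  graph :=
    { Adj := fun x y => D.Interlaced x y
      symm := ⟨fun x y h => ⟨h.1.symm, by
        obtain ⟨-, a, b, h | h⟩ := h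
        · exact ⟨b, a, Or.inr h⟩
        · exact ⟨b, a, Or.inl h⟩⟩⟩
      loopless := ⟨fun _ h => h.1 rfl⟩ }
  loops := {x | D.sign x = -1}

/-- The two passages of a strand, in the order `p`, `q` if `s = 1` and in the order `q`, `p`
if `s = -1`. -/
def strand (s : ℤˣ) (p q : Passage) : List Passage := if s = 1 then [p, q] else [q, p]

/-- The elementary relations between diagrams of one and the same knot: change of base point,
orientation and names, and the Reidemeister moves, including the moves for virtual
crossings. `omega1` and `omega2` are written as removals. In each move the crossings that
take part lie in a disc which is the neighbourhood of a face with one, two or three sides. -/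
inductive Move : KnotDiagram → KnotDiagram → Prop
  /-- Another base point. -/
  | rotate (D E : KnotDiagram) (k : ℕ) (hv : E.isVirtual = D.isVirtual) (hs : E.sign = D.sign)
      (hw : E.word = D.word.rotate k) : Move D E
  /-- The opposite orientation of the knot. -/
  | reverse (D E : KnotDiagram) (hv : E.isVirtual = D.isVirtual) (hs : E.sign = D.sign)
      (hw : E.word = D.word.reverse) : Move D E
  /-- Other names `f x` for the crossings, and at some virtual crossings an exchange of
  the names of the two passages, which reverses the sign. -/
  | rename (D E : KnotDiagram) (f : Equiv.Perm ℕ) (flip : ℕ → Bool)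
      (hflip : ∀ x, D.IsCrossing x → flip x = true → D.isVirtual x)
      (hv : ∀ x, D.IsCrossing x → (E.isVirtual (f x) ↔ D.isVirtual x))
      (hs : ∀ x, D.IsCrossing x → E.sign (f x) = if flip x then -D.sign x else D.sign x)
      (hw : E.word = D.word.map fun p => (f p.1, xor p.2 (flip p.1))) : Move D E
  /-- First moves (a kink is removed), for a classical or a virtual crossing `x`. -/
  | omega1 (D E : KnotDiagram) (x : ℕ) (b : Bool) (w : List Passage)
      (hv : E.isVirtual = D.isVirtual) (hs : E.sign = D.sign)
      (hD : D.word = [(x, b), (x, !b)] ++ w) (hE : E.word = w) : Move D E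
  /-- Second moves (two strands that bound a bigon are separated), both crossings
  being classical or both virtual. One strand is above the other if the crossings are
  classical. The two strands may run in the same or in opposite directions. -/
  | omega2 (D E : KnotDiagram) (x y : ℕ) (b : Bool) (second w₁ w₂ : List Passage)
      (hv : E.isVirtual = D.isVirtual) (hs : E.sign = D.sign)
      (hkind : D.isVirtual x ↔ D.isVirtual y)
      (hsign : D.sign x = -D.sign y)
      (hsecond : second = [(x, !b), (y, !b)] ∨ second = [(y, !b), (x, !b)])
      (hD : D.word = [(x, b), (y, b)] ++ w₁ ++ second ++ w₂)
      (hE : E.word = w₁ ++ w₂) : Move D E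
  /-- Third moves (one side of a triangle is moved across the opposite crossing).
  The strands `1`, `2`, `3` meet in the crossings `x` (of `1` and `2`), `y` (of `1` and `3`) and
  `z` (of `2` and `3`), which are the corners of a triangle. The corners `z`, `y`, `x` are in
  counterclockwise order if `t = 1`, in clockwise order if `t = -1`; and strand `i` runs along
  the triangle in the direction `z → y → x → z` iff `sᵢ = 1`. This
  determines the order of the passages on each strand and the signs of the crossings.
  Either all three crossings are classical, strand `1` being above strands `2` and `3`, and strand
  `2` above strand `3`; or strand `1` has virtual crossings with strands `2` and `3`, and `z` is
  classical or virtual. The move reverses the order of the passages on each strand. -/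
  | omega3 (D E : KnotDiagram) (x y z : ℕ) (t s₁ s₂ s₃ : ℤˣ) (w₁ w₂ w₃ : List Passage)
      (hv : E.isVirtual = D.isVirtual) (hs : E.sign = D.sign)
      (hkind : (¬ D.isVirtual x ∧ ¬ D.isVirtual y ∧ ¬ D.isVirtual z) ∨
        (D.isVirtual x ∧ D.isVirtual y))
      (hx : D.sign x = t * s₁ * s₂) (hy : D.sign y = -(t * s₁ * s₃)) (hz : D.sign z = t * s₂ * s₃)
      (hword :
        (D.word = strand s₁ (y, true) (x, true) ++ w₁ ++ strand s₂ (x, false) (z, true) ++ w₂ ++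
            strand s₃ (z, false) (y, false) ++ w₃ ∧
          E.word = strand (-s₁) (y, true) (x, true) ++ w₁ ++ strand (-s₂) (x, false) (z, true) ++
            w₂ ++ strand (-s₃) (z, false) (y, false) ++ w₃) ∨
        (D.word = strand s₁ (y, true) (x, true) ++ w₁ ++ strand s₃ (z, false) (y, false) ++ w₂ ++
            strand s₂ (x, false) (z, true) ++ w₃ ∧
          E.word = strand (-s₁) (y, true) (x, true) ++ w₁ ++ strand (-s₃) (z, false) (y, false) ++
            w₂ ++ strand (-s₂) (x, false) (z, true) ++ w₃)) : Move D E

/-- Two diagrams are diagrams of the same virtual knot. -/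
def SameVirtualKnot (D E : KnotDiagram) : Prop := Relation.EqvGen Move D E

/-- Equality of virtual knots, as an equivalence relation on diagrams. -/
def virtualSetoid : Setoid KnotDiagram := Relation.EqvGen.setoid Move

end KnotDiagram

/-- Virtual knots: diagrams modulo Reidemeister equivalence. -/
abbrev VirtualKnot : Type := Quotient KnotDiagram.virtualSetoid

/-- Classical knot diagrams: those without virtual crossings. -/
abbrev ClassicalDiagram : Type := {D : KnotDiagram // D.IsClassical}

namespace ClassicalDiagram

/-- Two classical diagrams are diagrams of the same classical knot: they are related by
a finite sequence of Reidemeister moves through classical diagrams. -/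
def SameClassicalKnot (D E : ClassicalDiagram) : Prop :=
  Relation.EqvGen (fun D E : ClassicalDiagram => KnotDiagram.Move D.1 E.1) D E

/-- Equality of classical knots, as an equivalence relation on classical diagrams. -/
def classicalSetoid : Setoid ClassicalDiagram :=
  Relation.EqvGen.setoid fun D E : ClassicalDiagram => KnotDiagram.Move D.1 E.1

end ClassicalDiagram

/-- Classical knots: classical diagrams modulo Reidemeister equivalence. -/
abbrev ClassicalKnot : Type := Quotient ClassicalDiagram.classicalSetoid

/-!
The interlacement graph depends only on the cyclic word of crossings (`KnotDiagram.chordWord`, in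
which every crossing occurs twice) and on the signs: two crossings are interlaced iff they
alternate in that word (`KnotDiagram.interlaced_iff`). Alternation of two letters depends only on
the subword formed by them (`alternate_congr`), and `c` alternates with `x` iff exactly one `c`
stands between the two occurrences of `x` (`alternate_iff_of_restrict_eq`).

Changes of base point, orientation and names give isomorphic graphs. A kink is an isolated vertex,
since nothing stands between its two passages. The corners of a bigon have opposite signs and the
same passages between their two occurrences, hence the same neighbours. For a triangle let `w₁`,
`w₂`, `w₃` be the arcs that join its three strands: a further crossing is interlaced with the three
corners according to the parities of its passages in `w₁`, in `w₂` and in `w₁ ++ w₂`, hence with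
none or with two of them (`alternate_corner_iff_count`). Two corners are interlaced iff the strand
that joins them has the sign `-1` (`alternate_corners`), so that reversing all strands toggles the
three adjacencies. The signs of the crossings are products of signs of strands, and running through
the possible signs one finds one of the six configurations before or after the toggle
(`LoopedGraph.move_toggle_of_strands`). Virtual crossings are not vertices, and a move in which
they take part changes neither the other vertices nor the adjacencies among them. Planarity of the
diagrams plays no role in the argument.
-/

/-! ### Words and alternating letters -/

/-- The letters `x` and `y` alternate in the word `u`: it contains `xyxy` or `yxyx` as a subword.
This is meant for words in which every letter occurs at most twice. -/
def Alternate (u : List ℕ) (x y : ℕ) : Prop :=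
  [x, y, x, y].Sublist u ∨ [y, x, y, x].Sublist u

/-- The subword of `u` formed by the letters `x` and `y`. -/
def restrict (x y : ℕ) (u : List ℕ) : List ℕ := u.filter fun c => c = x ∨ c = y

section Words

variable {u v w : List ℕ} {x y c : ℕ}

theorem restrict_append : restrict x y (u ++ v) = restrict x y u ++ restrict x y v :=
  List.filter_append ..

@[simp] theorem restrict_nil : restrict x y [] = [] := rfl

theorem restrict_cons : restrict x y (c :: u) =
    if c = x ∨ c = y then c :: restrict x y u else restrict x y u := by
  simp [restrict, List.filter_cons]

theorem restrict_of_notMem (hx : x ∉ u) : restrict x y u = List.replicate (u.count y) y := by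
  rw [restrict, ← List.filter_eq]
  refine List.filter_congr fun c hc => ?_
  have : c ≠ x := fun h => hx (h ▸ hc)
  simp [this, eq_comm]

theorem restrict_of_notMem_right (hy : y ∉ u) :
    restrict x y u = List.replicate (u.count x) x := by
  rw [← restrict_of_notMem hy, restrict, restrict]
  simp only [or_comm]

theorem restrict_eq_nil (hx : x ∉ u) (hy : y ∉ u) : restrict x y u = [] := by
  rw [restrict_of_notMem hx, List.count_eq_zero_of_not_mem hy, List.replicate_zero]

theorem alternate_comm : Alternate u x y ↔ Alternate u y x := Or.comm

theorem alternate_restrict : Alternate (restrict x y u) x y ↔ Alternate u x y := by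
  have key : ∀ l : List ℕ, (∀ c ∈ l, c = x ∨ c = y) →
      (l.Sublist (restrict x y u) ↔ l.Sublist u) := fun l hl =>
    ⟨fun h => h.trans List.filter_sublist, fun h => by
      have h' := h.filter fun c => decide (c = x ∨ c = y)
      rwa [List.filter_eq_self.2 (by simpa using hl)] at h'⟩
  unfold Alternate
  rw [key _ (by simp), key _ (by simp)]

theorem alternate_congr (h : restrict x y u = restrict x y v) :
    Alternate u x y ↔ Alternate v x y := by
  rw [← alternate_restrict, h, alternate_restrict]

/-- If `x` occurs exactly twice in a word and `c` occurs twice or not at all, then they alternate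
iff there is exactly one `c` between the two occurrences of `x`. -/
theorem alternate_iff_of_restrict_eq {k l m : ℕ} (hc : c ≠ x)
    (hu : restrict c x u = List.replicate k c ++ x :: (List.replicate l c ++
      x :: List.replicate m c))
    (hn : k + l + m = 0 ∨ k + l + m = 2) : Alternate u c x ↔ l = 1 := by
  rw [← alternate_restrict, hu]
  have hk : k ≤ 2 := by omega
  have hl : l ≤ 2 := by omega
  have hm : m ≤ 2 := by omega
  interval_cases k <;> interval_cases l <;> interval_cases m <;> first
    | omega
    | simp [Alternate, List.replicate, List.cons_sublist_cons', hc, hc.symm]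

theorem Alternate.append_swap (h : Alternate (u ++ v) x y) : Alternate (v ++ u) x y := by
  have swap : ∀ {x y : ℕ}, [x, y, x, y].Sublist (u ++ v) → Alternate (v ++ u) x y := by
    intro x y h
    obtain ⟨l₁, l₂, h, h₁, h₂⟩ := List.sublist_append_iff.1 h
    have h' := h₂.append h₁
    -- Every rotation of `xyxy` is `xyxy` or `yxyx`.
    simp only [List.cons_eq_append_iff, List.nil_eq_append_iff] at h
    unfold Alternate
    rcases h with ⟨rfl, rfl⟩ | ⟨_, rfl, ⟨rfl, rfl⟩ | ⟨_, rfl, ⟨rfl, rfl⟩ | ⟨_, rfl, ⟨rfl, rfl⟩ |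
      ⟨_, rfl, rfl, rfl⟩⟩⟩⟩
    all_goals first | exact Or.inl h' | exact Or.inr h'
  rcases h with h | h
  · exact swap h
  · exact alternate_comm.1 (swap h)

theorem alternate_rotate (k : ℕ) : Alternate (u.rotate k) x y ↔ Alternate u x y := by
  rw [List.rotate_eq_drop_append_take_mod]
  have h := List.take_append_drop (k % u.length) u
  constructor
  · intro h'
    simpa only [h] using h'.append_swap
  · intro h'
    rw [← h] at h'
    exact h'.append_swap

theorem alternate_reverse : Alternate u.reverse x y ↔ Alternate u x y := by
  have h : ∀ a b : ℕ, [a, b, a, b].Sublist u.reverse ↔ [b, a, b, a].Sublist u := fun a b => by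
    rw [← List.reverse_sublist]; simp
  unfold Alternate
  rw [h, h, or_comm]

theorem alternate_map {f : ℕ → ℕ} (hf : f.Injective) :
    Alternate (u.map f) (f x) (f y) ↔ Alternate u x y := by
  have h : ∀ a b : ℕ, [f a, f b, f a, f b].Sublist (u.map f) ↔ [a, b, a, b].Sublist u :=
    fun a b => by
      rw [show [f a, f b, f a, f b] = [a, b, a, b].map f from rfl]
      exact ⟨fun h => by
        obtain ⟨l, hl, h⟩ := List.sublist_map_iff.1 h
        rwa [List.map_injective_iff.2 hf h], fun h => h.map f⟩
  unfold Alternate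
  rw [h, h]

end Words

/-! ### The interlacement graph in terms of words -/

namespace KnotDiagram

/-- The crossings of `D` in the order in which they are met, each of them twice. -/
def chordWord (D : KnotDiagram) : List ℕ := D.word.map Prod.fst

/-- `x` is a vertex of the looped interlacement graph. -/
abbrev IsVertex (D : KnotDiagram) (x : ℕ) : Prop := D.IsCrossing x ∧ ¬ D.isVirtual x

variable {D E : KnotDiagram} {x y : ℕ}

/-- The vertex of the looped interlacement graph that stands for a classical crossing. -/
def vertex (h : D.IsVertex x) : D.loopedInterlacementGraph.V := ⟨x, h⟩

@[simp] theorem vertex_inj {hx : D.IsVertex x} {hy : D.IsVertex y} :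
    vertex hx = vertex hy ↔ x = y := Subtype.ext_iff

theorem mem_word_iff {b : Bool} : (x, b) ∈ D.word ↔ D.IsCrossing x := by
  cases b
  · exact ⟨fun h => D.twice x false h, fun h => D.twice x true h⟩
  · exact Iff.rfl

theorem mem_chordWord : x ∈ D.chordWord ↔ D.IsCrossing x := by
  simp only [chordWord, List.mem_map, Prod.exists, exists_and_right, exists_eq_right,
    mem_word_iff, exists_const]

theorem count_chordWord (h : D.IsCrossing x) : D.chordWord.count x = 2 := by
  rw [chordWord, List.count_eq_countP, List.countP_map, List.countP_eq_length_filter]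
  have : (D.word.filter fun p => p.1 = x).Perm [(x, true), (x, false)] := by
    refine (List.perm_ext_iff_of_nodup (D.nodup.filter _) (by simp)).2 fun ⟨a, b⟩ => ?_
    simp only [List.mem_filter, mem_word_iff, decide_eq_true_eq, List.mem_cons, Prod.mk.injEq,
      List.not_mem_nil, or_false]
    constructor
    · rintro ⟨-, rfl⟩
      cases b <;> simp
    · rintro (⟨rfl, -⟩ | ⟨rfl, -⟩) <;> exact ⟨h, rfl⟩
  simpa [Function.comp_def, beq_eq_decide] using this.length_eq

theorem count_chordWord_eq (x : ℕ) : D.chordWord.count x = 0 ∨ D.chordWord.count x = 2 := by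
  by_cases h : D.IsCrossing x
  · exact Or.inr (count_chordWord h)
  · exact Or.inl (List.count_eq_zero.2 (mem_chordWord.not.2 h))

theorem interlaced_iff : D.Interlaced x y ↔ x ≠ y ∧ Alternate D.chordWord x y := by
  have key : ∀ x y : ℕ, [x, y, x, y].Sublist D.chordWord ↔
      ∃ a b : Bool, [(x, a), (y, b), (x, !a), (y, !b)].Sublist D.word := by
    refine fun x y => ⟨fun h => ?_, fun ⟨a, b, h⟩ => h.map Prod.fst⟩
    obtain ⟨l, hl, h⟩ := List.sublist_map_iff.1 h
    obtain ⟨⟨x, a⟩, ⟨y, b⟩, ⟨x', a'⟩, ⟨y', b'⟩, rfl⟩ := List.length_eq_four.1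
      (by simpa using (congrArg List.length h).symm)
    simp only [List.map_cons, List.map_nil, List.cons.injEq, and_true] at h
    obtain ⟨rfl, rfl, rfl, rfl⟩ := h
    have hn := D.nodup.sublist hl
    refine ⟨a, b, ?_⟩
    convert hl using 5
    all_goals revert hn; cases a <;> cases a' <;> cases b <;> cases b' <;> simp
  unfold Interlaced Alternate
  rw [key, key]
  refine and_congr_right fun _ => ⟨?_, ?_⟩
  · rintro ⟨a, b, h | h⟩
    exacts [Or.inl ⟨a, b, h⟩, Or.inr ⟨b, a, h⟩]
  · rintro (⟨a, b, h⟩ | ⟨b, a, h⟩)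
    exacts [⟨a, b, Or.inl h⟩, ⟨a, b, Or.inr h⟩]

theorem isomorphic_of_perm (f : Equiv.Perm ℕ) (hV : ∀ c, E.IsVertex (f c) ↔ D.IsVertex c)
    (hs : ∀ c, D.IsVertex c → E.sign (f c) = D.sign c)
    (hI : ∀ c d, D.IsVertex c → D.IsVertex d → c ≠ d →
      (Alternate E.chordWord (f c) (f d) ↔ Alternate D.chordWord c d)) :
    D.loopedInterlacementGraph.Isomorphic E.loopedInterlacementGraph := by
  refine ⟨⟨f.subtypeEquiv fun c => (hV c).symm, ?_⟩, ?_⟩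
  · rintro ⟨c, hc⟩ ⟨d, hd⟩
    change E.Interlaced (f c) (f d) ↔ D.Interlaced c d
    rw [interlaced_iff, interlaced_iff, f.injective.ne_iff]
    exact and_congr_right (hI c d hc hd)
  · rintro ⟨c, hc⟩
    change E.sign (f c) = -1 ↔ D.sign c = -1
    rw [hs c hc]

theorem isomorphic_of_word (hV : ∀ c, E.IsVertex c ↔ D.IsVertex c) (hs : E.sign = D.sign)
    (hI : ∀ c d, D.IsVertex c → D.IsVertex d → c ≠ d →
      (Alternate E.chordWord c d ↔ Alternate D.chordWord c d)) :
    D.loopedInterlacementGraph.Isomorphic E.loopedInterlacementGraph :=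
  isomorphic_of_perm (Equiv.refl ℕ) hV (fun c _ => by rw [hs]; rfl) hI

/-- Removing the crossings in `S` from the word of a diagram removes them from the interlacement
graph. -/
theorem delete_isomorphic (S : Set D.loopedInterlacementGraph.V)
    (hV : ∀ c, E.IsVertex c ↔ ∃ h : D.IsVertex c, vertex h ∉ S) (hs : E.sign = D.sign)
    (hI : ∀ c d, E.IsVertex c → E.IsVertex d → c ≠ d →
      (Alternate E.chordWord c d ↔ Alternate D.chordWord c d)) :
    (D.loopedInterlacementGraph.delete S).Isomorphic E.loopedInterlacementGraph := by
  refine ⟨⟨⟨fun c => ⟨c.1.1, (hV _).2 ⟨c.1.2, c.2⟩⟩,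
    fun c => ⟨⟨c.1, ((hV _).1 c.2).1⟩, ((hV _).1 c.2).2⟩, fun _ => rfl, fun _ => rfl⟩, ?_⟩, ?_⟩
  · rintro ⟨⟨c, hc⟩, hc'⟩ ⟨⟨d, hd⟩, hd'⟩
    change E.Interlaced c d ↔ D.Interlaced c d
    rw [interlaced_iff, interlaced_iff]
    exact and_congr_right (hI c d ((hV _).2 ⟨hc, hc'⟩) ((hV _).2 ⟨hd, hd'⟩))
  · rintro ⟨⟨c, hc⟩, hc'⟩
    change E.sign c = -1 ↔ D.sign c = -1
    rw [hs]

theorem toggle_isomorphic (S : Set D.loopedInterlacementGraph.V)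
    (hV : ∀ c, E.IsVertex c ↔ D.IsVertex c) (hs : E.sign = D.sign)
    (hI : ∀ c d (hc : D.IsVertex c) (hd : D.IsVertex d), c ≠ d →
      (Alternate E.chordWord c d ↔
        Xor (Alternate D.chordWord c d) (vertex hc ∈ S ∧ vertex hd ∈ S))) :
    (D.loopedInterlacementGraph.toggle S).Isomorphic E.loopedInterlacementGraph := by
  refine ⟨⟨(Equiv.refl ℕ).subtypeEquiv fun c => (hV c).symm, ?_⟩, ?_⟩
  · rintro ⟨c, hc⟩ ⟨d, hd⟩
    change E.Interlaced c d ↔ vertex hc ≠ vertex hd ∧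
      Xor (D.Interlaced c d) _
    rw [interlaced_iff, interlaced_iff, ne_eq, ne_eq, vertex_inj]
    refine and_congr_right fun h => ?_
    rw [hI c d hc hd h]
    simp only [h, not_false_eq_true, true_and]
    exact Iff.rfl
  · rintro ⟨c, hc⟩
    change E.sign c = -1 ↔ D.sign c = -1
    rw [hs]

end KnotDiagram

/-! ### Words with a triangle -/

/-- The two letters of a strand, in the order `a`, `b` if `s = 1` and `b`, `a` if `s = -1`. -/
def strandLetters (s : ℤˣ) (a b : ℕ) : List ℕ := if s = 1 then [a, b] else [b, a]

/-- The word of a curve whose strands `1`, `2`, `3` are met in this order and bound a triangle with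
corners `x` (on `1` and `2`), `y` (on `1` and `3`), `z` (on `2` and `3`). -/
def triangleWord (x y z : ℕ) (s₁ s₂ s₃ : ℤˣ) (w₁ w₂ w₃ : List ℕ) : List ℕ :=
  strandLetters s₁ y x ++ w₁ ++ strandLetters s₂ x z ++ w₂ ++ strandLetters s₃ z y ++ w₃

theorem map_fst_strand (s : ℤˣ) (p q : Passage) :
    (KnotDiagram.strand s p q).map Prod.fst = strandLetters s p.1 q.1 := by
  unfold KnotDiagram.strand strandLetters
  split_ifs <;> rfl

theorem strandLetters_neg (s : ℤˣ) (a b : ℕ) : strandLetters (-s) a b = strandLetters s b a := by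
  rcases Int.units_eq_one_or s with rfl | rfl <;> simp [strandLetters]

@[simp] theorem count_strandLetters (s : ℤˣ) (a b c : ℕ) :
    (strandLetters s a b).count c = [a, b].count c := by
  unfold strandLetters
  split_ifs
  · rfl
  · exact (List.Perm.swap a b []).count_eq c

theorem restrict_strandLetters {s : ℤˣ} {a b c d : ℕ} (h : ¬ ((a = c ∨ a = d) ∧ (b = c ∨ b = d))) :
    restrict c d (strandLetters s a b) = restrict c d [a, b] := by
  unfold strandLetters
  split_ifs
  · rfl
  · simp only [restrict_cons, restrict_nil]
    split_ifs <;> first | rfl | tauto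

section Triangle

variable {x y z : ℕ} {s₁ s₂ s₃ : ℤˣ} {w₁ w₂ w₃ : List ℕ}

theorem triangleWord_perm :
    (triangleWord x y z (-s₁) (-s₂) (-s₃) w₁ w₂ w₃).Perm
      (triangleWord x y z s₁ s₂ s₃ w₁ w₂ w₃) := by
  rw [List.perm_iff_count]
  intro c
  simp only [triangleWord, List.count_append, count_strandLetters]

theorem ne_of_count_triangleWord
    (h : ∀ c, (triangleWord x y z s₁ s₂ s₃ w₁ w₂ w₃).count c ≤ 2) : x ≠ y ∧ x ≠ z ∧ y ≠ z := by
  have hx := h x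
  have hz := h z
  simp only [triangleWord, List.count_append, count_strandLetters, List.count_cons,
    List.count_nil] at hx hz
  refine ⟨?_, ?_, ?_⟩ <;> rintro rfl <;> simp at hx hz <;> omega

theorem notMem_of_count_triangleWord
    (h : ∀ c, (triangleWord x y z s₁ s₂ s₃ w₁ w₂ w₃).count c ≤ 2) {c : ℕ}
    (hc : c = x ∨ c = y ∨ c = z) : c ∉ w₁ ∧ c ∉ w₂ ∧ c ∉ w₃ := by
  have h' := h c
  simp only [triangleWord, List.count_append, count_strandLetters, List.count_cons,
    List.count_nil] at h'
  simp only [← List.count_eq_zero]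
  rcases hc with rfl | rfl | rfl <;> simp at h' <;> omega

/-- Reversing the strands of a triangle does not affect pairs of letters that involve a letter
other than the three corners. -/
theorem restrict_triangleWord_neg {c : ℕ} (d : ℕ) (hx : c ≠ x) (hy : c ≠ y) (hz : c ≠ z)
    (hxy : x ≠ y) (hxz : x ≠ z) (hyz : y ≠ z) :
    restrict c d (triangleWord x y z (-s₁) (-s₂) (-s₃) w₁ w₂ w₃) =
      restrict c d (triangleWord x y z s₁ s₂ s₃ w₁ w₂ w₃) := by
  simp only [triangleWord, restrict_append]
  rw [restrict_strandLetters (s := -s₁) (by omega), restrict_strandLetters (s := -s₂) (by omega),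
    restrict_strandLetters (s := -s₃) (by omega), restrict_strandLetters (s := s₁) (by omega),
    restrict_strandLetters (s := s₂) (by omega), restrict_strandLetters (s := s₃) (by omega)]

/-- Two corners of a triangle are interlaced iff the strand that joins them has sign `-1`. -/
theorem alternate_corners (h : ∀ c, (triangleWord x y z s₁ s₂ s₃ w₁ w₂ w₃).count c ≤ 2) :
    (Alternate (triangleWord x y z s₁ s₂ s₃ w₁ w₂ w₃) x y ↔ s₁ = -1) ∧
    (Alternate (triangleWord x y z s₁ s₂ s₃ w₁ w₂ w₃) x z ↔ s₂ = -1) ∧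
    (Alternate (triangleWord x y z s₁ s₂ s₃ w₁ w₂ w₃) y z ↔ s₃ = -1) := by
  obtain ⟨hxy, hxz, hyz⟩ := ne_of_count_triangleWord h
  obtain ⟨hx₁, hx₂, hx₃⟩ := notMem_of_count_triangleWord h (c := x) (by simp)
  obtain ⟨hy₁, hy₂, hy₃⟩ := notMem_of_count_triangleWord h (c := y) (by simp)
  obtain ⟨hz₁, hz₂, hz₃⟩ := notMem_of_count_triangleWord h (c := z) (by simp)
  refine ⟨?_, ?_, ?_⟩
  · rw [← alternate_restrict]
    simp only [triangleWord, restrict_append, restrict_eq_nil hx₁ hy₁, restrict_eq_nil hx₂ hy₂,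
      restrict_eq_nil hx₃ hy₃]
    rw [restrict_strandLetters (s := s₂) (by omega), restrict_strandLetters (s := s₃) (by omega)]
    rcases Int.units_eq_one_or s₁ with rfl | rfl <;>
      simp [strandLetters, restrict_cons, Alternate, List.cons_sublist_cons', hxy,
        hxy.symm, hxz.symm, hyz.symm]
  · rw [← alternate_restrict]
    simp only [triangleWord, restrict_append, restrict_eq_nil hx₁ hz₁, restrict_eq_nil hx₂ hz₂,
      restrict_eq_nil hx₃ hz₃]
    rw [restrict_strandLetters (s := s₁) (by omega), restrict_strandLetters (s := s₃) (by omega)]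
    rcases Int.units_eq_one_or s₂ with rfl | rfl <;>
      simp [strandLetters, restrict_cons, Alternate, List.cons_sublist_cons', hxz,
        hyz, hxy.symm, hxz.symm]
  · rw [← alternate_restrict]
    simp only [triangleWord, restrict_append, restrict_eq_nil hy₁ hz₁, restrict_eq_nil hy₂ hz₂,
      restrict_eq_nil hy₃ hz₃]
    rw [restrict_strandLetters (s := s₁) (by omega), restrict_strandLetters (s := s₂) (by omega)]
    rcases Int.units_eq_one_or s₃ with rfl | rfl <;>
      simp [strandLetters, restrict_cons, Alternate, List.cons_sublist_cons', hxy,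
        hxz, hyz, hyz.symm]

/-- Interlacement of a further crossing `c` with the corners of a triangle, in terms of the number
of its passages in the three arcs that join the strands. -/
theorem alternate_corner_iff_count {c : ℕ} (hx : c ≠ x) (hy : c ≠ y) (hz : c ≠ z)
    (h : ∀ c, (triangleWord x y z s₁ s₂ s₃ w₁ w₂ w₃).count c ≤ 2)
    (hc : w₁.count c + w₂.count c + w₃.count c = 0 ∨ w₁.count c + w₂.count c + w₃.count c = 2) :
    (Alternate (triangleWord x y z s₁ s₂ s₃ w₁ w₂ w₃) c x ↔ w₁.count c = 1) ∧
    (Alternate (triangleWord x y z s₁ s₂ s₃ w₁ w₂ w₃) c y ↔ w₁.count c + w₂.count c = 1) ∧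
    (Alternate (triangleWord x y z s₁ s₂ s₃ w₁ w₂ w₃) c z ↔ w₂.count c = 1) := by
  obtain ⟨hxy, hxz, hyz⟩ := ne_of_count_triangleWord h
  obtain ⟨hx₁, hx₂, hx₃⟩ := notMem_of_count_triangleWord h (c := x) (by simp)
  obtain ⟨hy₁, hy₂, hy₃⟩ := notMem_of_count_triangleWord h (c := y) (by simp)
  obtain ⟨hz₁, hz₂, hz₃⟩ := notMem_of_count_triangleWord h (c := z) (by simp)
  refine ⟨?_, ?_, ?_⟩
  · refine alternate_iff_of_restrict_eq (k := 0) (m := w₂.count c + w₃.count c) hx ?_ (by omega)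
    simp only [triangleWord, restrict_append, restrict_of_notMem_right hx₁,
      restrict_of_notMem_right hx₂, restrict_of_notMem_right hx₃]
    rw [restrict_strandLetters (s := s₁) (by omega), restrict_strandLetters (s := s₂) (by omega),
      restrict_strandLetters (s := s₃) (by omega)]
    simp [restrict_cons, hx.symm, hy.symm, hz.symm, hxy.symm, hxz.symm]
  · refine alternate_iff_of_restrict_eq (k := 0) (m := w₃.count c) hy ?_ (by omega)
    simp only [triangleWord, restrict_append, restrict_of_notMem_right hy₁,
      restrict_of_notMem_right hy₂, restrict_of_notMem_right hy₃]
    rw [restrict_strandLetters (s := s₁) (by omega), restrict_strandLetters (s := s₂) (by omega),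
      restrict_strandLetters (s := s₃) (by omega)]
    simp [restrict_cons, hx.symm, hy.symm, hz.symm, hxy, hyz.symm]
  · refine alternate_iff_of_restrict_eq (k := w₁.count c) (m := w₃.count c) hz ?_ (by omega)
    simp only [triangleWord, restrict_append, restrict_of_notMem_right hz₁,
      restrict_of_notMem_right hz₂, restrict_of_notMem_right hz₃]
    rw [restrict_strandLetters (s := s₁) (by omega), restrict_strandLetters (s := s₂) (by omega),
      restrict_strandLetters (s := s₃) (by omega)]
    simp [restrict_cons, hx.symm, hy.symm, hz.symm, hxz, hyz]

end Triangle

/-! ### The third move on looped graphs -/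

namespace LoopedGraph

theorem toggle_adj {G : LoopedGraph} {S : Set G.V} {x y : G.V} (h : x ≠ y) (hx : x ∈ S)
    (hy : y ∈ S) : (G.toggle S).graph.Adj x y ↔ ¬ G.graph.Adj x y := by
  change x ≠ y ∧ Xor (G.graph.Adj x y) (x ∈ S ∧ y ∈ S) ↔ _
  simp [h, hx, hy, xor_def]

/-- The condition on the other vertices in the third move, in a form that does not depend on the
order of the three vertices: each of them is adjacent to an even number of the three. -/
def MeetsEvenly (G : LoopedGraph) (l : List G.V) : Prop :=
  open Classical in ∀ c ∉ l, Even (l.countP fun u => G.graph.Adj c u)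

theorem meetsEvenly_iff {G : LoopedGraph} {u v w : G.V} : G.MeetsEvenly [u, v, w] ↔
    ∀ c, c ≠ u → c ≠ v → c ≠ w →
      (¬ G.graph.Adj c u ∧ ¬ G.graph.Adj c v ∧ ¬ G.graph.Adj c w) ∨
      (¬ G.graph.Adj c u ∧ G.graph.Adj c v ∧ G.graph.Adj c w) ∨
      (G.graph.Adj c u ∧ ¬ G.graph.Adj c v ∧ G.graph.Adj c w) ∨
      (G.graph.Adj c u ∧ G.graph.Adj c v ∧ ¬ G.graph.Adj c w) := by
  simp only [MeetsEvenly, List.mem_cons, List.not_mem_nil, or_false, not_or, and_imp]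
  refine forall₄_congr fun c _ _ _ => ?_
  by_cases hu : G.graph.Adj c u <;> by_cases hv : G.graph.Adj c v <;>
    by_cases hw : G.graph.Adj c w <;> simp [hu, hv, hw, Nat.even_iff]

theorem move_toggle_of_perm {G : LoopedGraph} {u v w x y z : G.V}
    (hp : [u, v, w].Perm [x, y, z]) (hn : [x, y, z].Nodup) (h : G.MeetsEvenly [x, y, z])
    (hc : G.IsTriangleConfiguration u v w ∨ (G.toggle {u, v, w}).IsTriangleConfiguration u v w) :
    Move G (G.toggle {x, y, z}) := by
  have hS : ({x, y, z} : Set G.V) = {u, v, w} := by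
    ext c
    simpa using (hp.mem_iff (a := c)).symm
  have h' : G.MeetsEvenly [u, v, w] := fun c hcl => by
    rw [hp.countP_eq]
    exact h c (hp.mem_iff.not.1 hcl)
  have hn' := hp.nodup_iff.2 hn
  simp only [List.nodup_cons, List.mem_cons, List.not_mem_nil, or_false, not_or] at hn'
  rw [hS]
  exact Move.omega3 G u v w hn'.1.1 hn'.1.2 hn'.2.1 (meetsEvenly_iff.1 h') hc

theorem isTriangleConfiguration_toggle {G : LoopedGraph} {u v w : G.V} (hn : [u, v, w].Nodup) :
    (G.toggle {u, v, w}).IsTriangleConfiguration u v w ↔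
      (¬ G.graph.Adj u v ∧ ¬ G.graph.Adj u w ∧ G.graph.Adj v w ∧
        ((u ∈ G.loops ∧ v ∈ G.loops ∧ w ∈ G.loops) ∨
        (u ∉ G.loops ∧ v ∉ G.loops ∧ w ∉ G.loops) ∨
        (u ∈ G.loops ∧ v ∈ G.loops ∧ w ∉ G.loops) ∨
        (u ∉ G.loops ∧ v ∈ G.loops ∧ w ∉ G.loops))) ∨
      (¬ G.graph.Adj u v ∧ ¬ G.graph.Adj u w ∧ ¬ G.graph.Adj v w ∧
        ((u ∈ G.loops ∧ v ∈ G.loops ∧ w ∉ G.loops) ∨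
        (u ∈ G.loops ∧ v ∉ G.loops ∧ w ∉ G.loops))) := by
  simp only [List.nodup_cons, List.mem_cons, List.not_mem_nil, or_false, not_or] at hn
  unfold IsTriangleConfiguration
  rw [toggle_adj hn.1.1 (by simp) (by simp), toggle_adj hn.1.2 (by simp) (by simp),
    toggle_adj hn.2.1 (by simp) (by simp), not_not]
  rfl

/-- If adjacencies and loops at three vertices `x`, `y`, `z` are determined by signs of strands as
in the interlacement graph of a triangle, then before or after the toggle the vertices span one of
the six configurations: if the three strands have the same sign, a triangle; otherwise, a path with
centre opposite to the exceptional strand. -/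
theorem move_toggle_of_strands (G : LoopedGraph) {x y z : G.V} (hn : [x, y, z].Nodup)
    {a b s₁ s₂ s₃ : ℤˣ}
    (axy : G.graph.Adj x y ↔ s₁ = -1) (axz : G.graph.Adj x z ↔ s₂ = -1)
    (ayz : G.graph.Adj y z ↔ s₃ = -1)
    (lx : x ∈ G.loops ↔ a * s₁ * s₂ = -1) (ly : y ∈ G.loops ↔ -(a * s₁ * s₃) = -1)
    (lz : z ∈ G.loops ↔ b * s₂ * s₃ = -1) (h : G.MeetsEvenly [x, y, z]) :
    Move G (G.toggle {x, y, z}) := by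
  have key : ∀ u v w : G.V, [u, v, w].Perm [x, y, z] → _ → Move G (G.toggle {x, y, z}) :=
    fun u v w hp hc => move_toggle_of_perm hp hn h
      ((or_congr_right (isTriangleConfiguration_toggle (hp.nodup_iff.2 hn))).2 hc)
  have ayx := (G.graph.adj_comm y x).trans axy
  have azx := (G.graph.adj_comm z x).trans axz
  have azy := (G.graph.adj_comm z y).trans ayz
  have h₁ : (1 : ℤˣ) ≠ -1 := by decide
  have pxzy : [x, z, y].Perm [x, y, z] := (List.Perm.swap ..).cons _
  have pyxz : [y, x, z].Perm [x, y, z] := List.Perm.swap ..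
  have pyzx : [y, z, x].Perm [x, y, z] := ((List.Perm.swap ..).cons _).trans pyxz
  have pzxy : [z, x, y].Perm [x, y, z] := (List.Perm.swap ..).trans pxzy
  have pzyx : [z, y, x].Perm [x, y, z] := ((List.Perm.swap ..).cons _).trans pzxy
  unfold IsTriangleConfiguration at key
  clear h hn
  rcases Int.units_eq_one_or a with rfl | rfl <;> rcases Int.units_eq_one_or b with rfl | rfl <;>
  rcases Int.units_eq_one_or s₁ with rfl | rfl <;> rcases Int.units_eq_one_or s₂ with rfl | rfl <;>
  rcases Int.units_eq_one_or s₃ with rfl | rfl <;>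
  simp only [mul_one, mul_neg, neg_neg, h₁, iff_true, iff_false]
    at axy axz ayz ayx azx azy lx ly lz <;>
  first
  | (refine key x y z (List.Perm.refl _) ?_; simp [axy, axz, ayz, lx, ly, lz]; done)
  | (refine key x z y pxzy ?_; simp [axz, axy, azy, lx, ly, lz]; done)
  | (refine key y x z pyxz ?_; simp [ayx, ayz, axz, lx, ly, lz]; done)
  | (refine key y z x pyzx ?_; simp [ayx, ayz, azx, lx, ly, lz]; done)
  | (refine key z x y pzxy ?_; simp [azx, azy, axy, lx, ly, lz]; done)
  | (refine key z y x pzyx ?_; simp [azy, azx, ayx, lx, ly, lz])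

end LoopedGraph

/-! ### Invariance under the moves on diagrams -/

namespace KnotDiagram

variable {D E : KnotDiagram}

theorem reidemeisterEquivalent_of_isomorphic
    (h : D.loopedInterlacementGraph.Isomorphic E.loopedInterlacementGraph) :
    LoopedGraph.ReidemeisterEquivalent D.loopedInterlacementGraph E.loopedInterlacementGraph :=
  .rel _ _ (.iso h)

theorem isCrossing_congr {u : List ℕ} (hw : E.chordWord = u) {c : ℕ} : E.IsCrossing c ↔ c ∈ u := by
  rw [← mem_chordWord, hw]

/-- Removing a kink removes an isolated vertex, or changes nothing if the crossing is virtual. -/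
theorem reidemeisterEquivalent_of_kink {x : ℕ} {w : List ℕ} (hv : E.isVirtual = D.isVirtual)
    (hs : E.sign = D.sign) (hD : D.chordWord = x :: x :: w) (hE : E.chordWord = w) :
    LoopedGraph.ReidemeisterEquivalent D.loopedInterlacementGraph E.loopedInterlacementGraph := by
  have hxw : x ∉ w := by
    have := count_chordWord_eq (D := D) x
    rw [hD, List.count_cons_self, List.count_cons_self] at this
    exact List.count_eq_zero.1 (by omega)
  have hDc : ∀ c, D.IsCrossing c ↔ c = x ∨ c ∈ w := fun c => by simp [isCrossing_congr hD]
  have hEc : ∀ c, E.IsCrossing c ↔ c ∈ w := fun c => isCrossing_congr hE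
  have hI : ∀ c d, c ≠ x → d ≠ x → (Alternate E.chordWord c d ↔ Alternate D.chordWord c d) := by
    intro c d hc hd
    refine alternate_congr ?_
    simp [hD, hE, restrict_cons, hc.symm, hd.symm]
  by_cases hx : D.isVirtual x
  · refine reidemeisterEquivalent_of_isomorphic (isomorphic_of_word (fun c => ?_) hs ?_)
    · unfold IsVertex
      rw [hDc, hEc, hv]
      refine and_congr_left fun hc => (or_iff_right ?_).symm
      rintro rfl
      exact hc hx
    · intro c d hc hd _
      exact hI c d (fun h => hc.2 (h ▸ hx)) (fun h => hd.2 (h ▸ hx))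
  · have hxD : D.IsVertex x := ⟨(hDc x).2 (Or.inl rfl), hx⟩
    have hne : ∀ {c}, E.IsVertex c → c ≠ x := fun h₁ h₂ => hxw (h₂ ▸ (hEc _).1 h₁.1)
    refine .trans _ _ _ (.rel _ _ (.omega1 _ (vertex hxD) ?_))
      (.rel _ _ (.iso (delete_isomorphic _ (fun c => ?_) hs
        fun c d hc hd _ => hI c d (hne hc) (hne hd))))
    · rintro ⟨c, hc⟩ h
      obtain ⟨hxc, h⟩ : x ≠ c ∧ Alternate D.chordWord x c := interlaced_iff.1 h
      have hc₀ := count_chordWord_eq (D := D) c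
      rw [hD, List.count_cons_of_ne hxc, List.count_cons_of_ne hxc] at hc₀
      rw [alternate_comm, alternate_iff_of_restrict_eq (k := 0) (l := 0) (m := w.count c) hxc.symm
        (by simp [hD, restrict_cons, restrict_of_notMem_right hxw]) (by omega)] at h
      exact zero_ne_one h
    · constructor
      · intro hc
        refine ⟨⟨(hDc c).2 (Or.inr ((hEc c).1 hc.1)), hv ▸ hc.2⟩, fun h => hne hc ?_⟩
        exact congrArg Subtype.val (Set.mem_singleton_iff.1 h)
      · rintro ⟨hc, h⟩
        refine ⟨(hEc c).2 (((hDc c).1 hc.1).resolve_left fun h' => h ?_), hv ▸ hc.2⟩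
        exact Set.mem_singleton_iff.2 (Subtype.ext h')

/-- Removing a bigon removes two vertices with opposite loop status and the same other neighbours,
or changes nothing if the crossings are virtual. -/
theorem reidemeisterEquivalent_of_bigon {x y : ℕ} {second w₁ w₂ : List ℕ}
    (hv : E.isVirtual = D.isVirtual) (hs : E.sign = D.sign)
    (hkind : D.isVirtual x ↔ D.isVirtual y) (hsign : D.sign x = -D.sign y)
    (hsecond : second = [x, y] ∨ second = [y, x])
    (hD : D.chordWord = [x, y] ++ w₁ ++ second ++ w₂) (hE : E.chordWord = w₁ ++ w₂) :
    LoopedGraph.ReidemeisterEquivalent D.loopedInterlacementGraph E.loopedInterlacementGraph := by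
  have hxy : x ≠ y := by
    rintro rfl
    rcases Int.units_eq_one_or (D.sign x) with h | h <;> rw [h] at hsign <;> revert hsign <;> decide
  have hcount : ∀ c, second.count c = [x, y].count c := by
    rcases hsecond with rfl | rfl
    · exact fun c => rfl
    · exact (List.Perm.swap x y []).count_eq
  have hx₀ := count_chordWord_eq (D := D) x
  have hy₀ := count_chordWord_eq (D := D) y
  simp only [hD, List.count_append, hcount, List.count_cons_self, List.count_cons_of_ne hxy,
    List.count_cons_of_ne hxy.symm, List.count_nil] at hx₀ hy₀
  have hx₁ : x ∉ w₁ := List.count_eq_zero.1 (by omega)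
  have hx₂ : x ∉ w₂ := List.count_eq_zero.1 (by omega)
  have hy₁ : y ∉ w₁ := List.count_eq_zero.1 (by omega)
  have hy₂ : y ∉ w₂ := List.count_eq_zero.1 (by omega)
  have hmem : ∀ c, c ∈ second ↔ c = x ∨ c = y := by
    rcases hsecond with rfl | rfl <;> simp [or_comm]
  have hDc : ∀ c, D.IsCrossing c ↔ c = x ∨ c = y ∨ c ∈ w₁ ++ w₂ := fun c => by
    simp only [isCrossing_congr hD, List.mem_append, List.mem_cons, List.not_mem_nil, hmem]
    tauto
  have hEc : ∀ c, E.IsCrossing c ↔ c ∈ w₁ ++ w₂ := fun c => isCrossing_congr hE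
  have hI : ∀ c d, c ≠ x → c ≠ y → d ≠ x → d ≠ y →
      (Alternate E.chordWord c d ↔ Alternate D.chordWord c d) := by
    intro c d hcx hcy hdx hdy
    refine alternate_congr ?_
    rcases hsecond with rfl | rfl <;>
      simp [hD, hE, restrict_append, restrict_cons, hcx.symm, hcy.symm, hdx.symm, hdy.symm]
  by_cases hx : D.isVirtual x
  · have hy := hkind.1 hx
    have hne : ∀ {c z}, D.IsVertex c → D.isVirtual z → c ≠ z := fun h₁ h₂ h₃ => h₁.2 (h₃ ▸ h₂)
    refine reidemeisterEquivalent_of_isomorphic (isomorphic_of_word (fun c => ?_) hs ?_)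
    · unfold IsVertex
      rw [hDc, hEc, hv]
      refine and_congr_left fun hc => ?_
      have hcx : c ≠ x := fun h => hc (h ▸ hx)
      have hcy : c ≠ y := fun h => hc (h ▸ hy)
      simp only [hcx, hcy, false_or]
    · intro c d hc hd _
      exact hI c d (hne hc hx) (hne hc hy) (hne hd hx) (hne hd hy)
  · have hxD : D.IsVertex x := ⟨(hDc x).2 (by simp), hx⟩
    have hyD : D.IsVertex y := ⟨(hDc y).2 (by simp), hkind.not.1 hx⟩
    have hw : ∀ {c}, E.IsVertex c → c ≠ x ∧ c ≠ y := fun h => by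
      have := (hEc _).1 h.1
      constructor <;> rintro rfl <;> simp_all
    -- Any other crossing has the same number of passages between the two passages of `x` as between
    -- those of `y`, namely its passages in `w₁`.
    have hnbr : ∀ c, c ≠ x → c ≠ y →
        (D.Interlaced c x ↔ D.Interlaced c y) := by
      intro c hcx hcy
      have hc := count_chordWord_eq (D := D) c
      simp only [hD, List.count_append, hcount, List.count_cons_of_ne hcx.symm,
        List.count_cons_of_ne hcy.symm, List.count_nil] at hc
      rw [interlaced_iff, interlaced_iff, and_iff_right hcx, and_iff_right hcy,
        alternate_iff_of_restrict_eq (k := 0) (l := w₁.count c) (m := w₂.count c) hcx _ (by omega),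
        alternate_iff_of_restrict_eq (k := 0) (l := w₁.count c) (m := w₂.count c) hcy _ (by omega)]
      all_goals
        rcases hsecond with rfl | rfl <;>
        simp [hD, restrict_append, restrict_cons, restrict_of_notMem_right, hx₁, hx₂, hy₁, hy₂,
          hcx.symm, hcy.symm, hxy, hxy.symm]
    have homega2 : ∃ v w : D.loopedInterlacementGraph.V,
        ({v, w} : Set _) = {vertex hxD, vertex hyD} ∧
        v ∈ D.loopedInterlacementGraph.loops ∧ w ∉ D.loopedInterlacementGraph.loops ∧
        ∀ c, c ≠ v → c ≠ w → (D.loopedInterlacementGraph.graph.Adj c v ↔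
          D.loopedInterlacementGraph.graph.Adj c w) := by
      have hn : ∀ c : D.loopedInterlacementGraph.V, c ≠ vertex hxD → c ≠ vertex hyD →
          (D.Interlaced c.1 x ↔ D.Interlaced c.1 y) := fun c h₁ h₂ =>
        hnbr c.1 (fun h => h₁ (Subtype.ext h)) fun h => h₂ (Subtype.ext h)
      rcases Int.units_eq_one_or (D.sign y) with h | h
      · refine ⟨vertex hxD, vertex hyD, rfl, ?_, ?_, hn⟩
        · exact hsign.trans (by rw [h])
        · exact fun h' => absurd (h.symm.trans h') (by decide)
      · refine ⟨vertex hyD, vertex hxD, Set.pair_comm _ _, h, ?_, fun c h₁ h₂ => (hn c h₂ h₁).symm⟩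
        rw [h, neg_neg] at hsign
        exact fun h' => absurd (hsign.symm.trans h') (by decide)
    obtain ⟨v, w, hvw, hv₁, hw₁, hn⟩ := homega2
    refine .trans _ _ _ (.rel _ _ (.omega2 _ v w hv₁ hw₁ hn)) (.rel _ _ (.iso ?_))
    rw [hvw]
    refine delete_isomorphic _ (fun c => ?_) hs fun c d hc hd _ =>
      hI c d (hw hc).1 (hw hc).2 (hw hd).1 (hw hd).2
    constructor
    · intro hc
      refine ⟨⟨(hDc c).2 (Or.inr (Or.inr ((hEc c).1 hc.1))), hv ▸ hc.2⟩, ?_⟩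
      rintro (h | h)
      exacts [(hw hc).1 (congrArg Subtype.val h), (hw hc).2 (congrArg Subtype.val h)]
    · rintro ⟨hc, h⟩
      refine ⟨(hEc c).2 ?_, hv ▸ hc.2⟩
      rcases (hDc c).1 hc.1 with h' | h' | h'
      exacts [(h (Or.inl (Subtype.ext h'))).elim, (h (Or.inr (Subtype.ext h'))).elim, h']

/-- Reversing the strands of a triangle toggles the adjacencies among its corners, or changes
nothing if two of the corners are virtual. The independent signs `a` and `b` cover both cyclic
orders of the three strands along the curve. -/
theorem reidemeisterEquivalent_of_triangle {x y z : ℕ} {a b s₁ s₂ s₃ : ℤˣ} {w₁ w₂ w₃ : List ℕ}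
    (hv : E.isVirtual = D.isVirtual) (hs : E.sign = D.sign)
    (hkind : (¬ D.isVirtual x ∧ ¬ D.isVirtual y ∧ ¬ D.isVirtual z) ∨
      (D.isVirtual x ∧ D.isVirtual y))
    (hx : D.sign x = a * s₁ * s₂) (hy : D.sign y = -(a * s₁ * s₃)) (hz : D.sign z = b * s₂ * s₃)
    (hD : D.chordWord = triangleWord x y z s₁ s₂ s₃ w₁ w₂ w₃)
    (hE : E.chordWord = triangleWord x y z (-s₁) (-s₂) (-s₃) w₁ w₂ w₃) :
    LoopedGraph.ReidemeisterEquivalent D.loopedInterlacementGraph E.loopedInterlacementGraph := by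
  have hcD : ∀ c, (triangleWord x y z s₁ s₂ s₃ w₁ w₂ w₃).count c ≤ 2 := fun c => by
    have := count_chordWord_eq (D := D) c
    rw [hD] at this
    omega
  have hcE : ∀ c, (triangleWord x y z (-s₁) (-s₂) (-s₃) w₁ w₂ w₃).count c ≤ 2 := fun c => by
    rw [triangleWord_perm.count_eq]
    exact hcD c
  obtain ⟨hxy, hxz, hyz⟩ := ne_of_count_triangleWord hcD
  have hV : ∀ c, E.IsVertex c ↔ D.IsVertex c := fun c => by
    unfold IsVertex
    rw [isCrossing_congr hE, isCrossing_congr hD, triangleWord_perm.mem_iff, hv]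
  have hI : ∀ c d, (c ≠ x ∧ c ≠ y ∧ c ≠ z) ∨ (d ≠ x ∧ d ≠ y ∧ d ≠ z) →
      (Alternate E.chordWord c d ↔ Alternate D.chordWord c d) := by
    rintro c d (h | h)
    · refine alternate_congr ?_
      rw [hE, hD, restrict_triangleWord_neg d h.1 h.2.1 h.2.2 hxy hxz hyz]
    · rw [alternate_comm, alternate_comm (u := D.chordWord)]
      refine alternate_congr ?_
      rw [hE, hD, restrict_triangleWord_neg c h.1 h.2.1 h.2.2 hxy hxz hyz]
  rcases hkind with ⟨vx, vy, vz⟩ | ⟨vx, vy⟩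
  · have hmem : ∀ c, c = x ∨ c = y ∨ c = z → D.IsCrossing c := fun c hc => by
      rw [isCrossing_congr hD, ← List.count_pos_iff]
      simp only [triangleWord, List.count_append, count_strandLetters, List.count_cons]
      rcases hc with rfl | rfl | rfl <;> simp
    have hxD : D.IsVertex x := ⟨hmem x (by simp), vx⟩
    have hyD : D.IsVertex y := ⟨hmem y (by simp), vy⟩
    have hzD : D.IsVertex z := ⟨hmem z (by simp), vz⟩
    obtain ⟨dxy, dxz, dyz⟩ := alternate_corners hcD
    obtain ⟨exy, exz, eyz⟩ := alternate_corners hcE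
    rw [← hD] at dxy dxz dyz
    rw [← hE] at exy exz eyz
    have hneg : ∀ s : ℤˣ, -s = -1 ↔ ¬ s = -1 := by decide
    have hn : [vertex hxD, vertex hyD, vertex hzD].Nodup := by
      simp [hxy, hxz, hyz]
    have hsgn : ∀ {c : ℕ} (hc : D.IsVertex c) {s : ℤˣ}, D.sign c = s →
        (vertex hc ∈ D.loopedInterlacementGraph.loops ↔ s = -1) :=
      fun {c} hc {s} h => by
        change D.sign c = -1 ↔ _
        rw [h]
    refine .trans _ _ _ (.rel _ _ (LoopedGraph.move_toggle_of_strands _ hn ?_ ?_ ?_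
      (hsgn _ hx) (hsgn _ hy) (hsgn _ hz) ?_))
      (.rel _ _ (.iso (toggle_isomorphic _ hV hs fun c d hc hd hcd => ?_)))
    · exact interlaced_iff.trans ((and_iff_right hxy).trans dxy)
    · exact interlaced_iff.trans ((and_iff_right hxz).trans dxz)
    · exact interlaced_iff.trans ((and_iff_right hyz).trans dyz)
    · refine LoopedGraph.meetsEvenly_iff.2 ?_
      rintro ⟨c, hc⟩ hcx hcy hcz
      replace hcx : c ≠ x := fun h => hcx (vertex_inj.2 h)
      replace hcy : c ≠ y := fun h => hcy (vertex_inj.2 h)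
      replace hcz : c ≠ z := fun h => hcz (vertex_inj.2 h)
      change (¬ D.Interlaced c x ∧ ¬ D.Interlaced c y ∧ ¬ D.Interlaced c z) ∨
        (¬ D.Interlaced c x ∧ D.Interlaced c y ∧ D.Interlaced c z) ∨
        (D.Interlaced c x ∧ ¬ D.Interlaced c y ∧ D.Interlaced c z) ∨
        (D.Interlaced c x ∧ D.Interlaced c y ∧ ¬ D.Interlaced c z)
      have hcc := count_chordWord_eq (D := D) c
      simp only [hD, triangleWord, List.count_append, count_strandLetters, List.count_cons,
        List.count_nil, beq_iff_eq, Ne.symm hcx, Ne.symm hcy, Ne.symm hcz, if_false] at hcc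
      obtain ⟨ax, ay, az⟩ := alternate_corner_iff_count hcx hcy hcz hcD (by omega)
      simp only [interlaced_iff, hD, ax, ay, az, ne_eq, hcx, hcy, hcz, not_false_eq_true, true_and]
      omega
    · simp only [Set.mem_insert_iff, Set.mem_singleton_iff, vertex_inj]
      by_cases h : (c = x ∨ c = y ∨ c = z) ∧ (d = x ∨ d = y ∨ d = z)
      · have goal : Alternate E.chordWord c d ↔ ¬ Alternate D.chordWord c d := by
          have exy' := alternate_comm.trans exy
          have exz' := alternate_comm.trans exz
          have eyz' := alternate_comm.trans eyz
          have dxy' := alternate_comm.trans dxy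
          have dxz' := alternate_comm.trans dxz
          have dyz' := alternate_comm.trans dyz
          rcases h with ⟨rfl | rfl | rfl, rfl | rfl | rfl⟩ <;>
          first
          | exact absurd rfl hcd
          | simp only [dxy, dxz, dyz, exy, exz, eyz, dxy', dxz', dyz', exy', exz', eyz', hneg]
        rw [goal]
        simp only [h, and_self]
        simp [xor_def]
      · rw [hI c d (by simpa only [not_and_or, not_or, ← ne_eq] using h)]
        simp only [h]
        simp [xor_def]
  · refine reidemeisterEquivalent_of_isomorphic (isomorphic_of_word hV hs fun c d hc hd hcd =>
      hI c d ?_)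
    have hne : ∀ {c v}, D.IsVertex c → D.isVirtual v → c ≠ v := fun h₁ h₂ h₃ => h₁.2 (h₃ ▸ h₂)
    have h₁ := hne hc vx
    have h₂ := hne hc vy
    have h₃ := hne hd vx
    have h₄ := hne hd vy
    omega

theorem Move.reidemeisterEquivalent (h : Move D E) :
    LoopedGraph.ReidemeisterEquivalent D.loopedInterlacementGraph E.loopedInterlacementGraph := by
  cases h with
  | rotate k hv hs hw =>
    have hw' : E.chordWord = D.chordWord.rotate k := by rw [chordWord, hw, List.map_rotate]; rfl
    refine reidemeisterEquivalent_of_isomorphic (isomorphic_of_word (fun c => ?_) hs ?_)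
    · unfold IsVertex
      rw [← mem_chordWord, hw', List.mem_rotate, mem_chordWord, hv]
    · intro c d _ _ _
      rw [hw', alternate_rotate]
  | reverse hv hs hw =>
    have hw' : E.chordWord = D.chordWord.reverse := by rw [chordWord, hw, List.map_reverse]; rfl
    refine reidemeisterEquivalent_of_isomorphic (isomorphic_of_word (fun c => ?_) hs ?_)
    · unfold IsVertex
      rw [← mem_chordWord, hw', List.mem_reverse, mem_chordWord, hv]
    · intro c d _ _ _
      rw [hw', alternate_reverse]
  | rename f flip hflip hv hs hw =>
    have hw' : E.chordWord = D.chordWord.map f := by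
      rw [chordWord, chordWord, hw, List.map_map, List.map_map]; rfl
    have hc : ∀ c, E.IsCrossing (f c) ↔ D.IsCrossing c := fun c => by
      rw [← mem_chordWord, hw', List.mem_map_of_injective f.injective, mem_chordWord]
    refine reidemeisterEquivalent_of_isomorphic (isomorphic_of_perm f (fun c => ?_) ?_ ?_)
    · unfold IsVertex
      rw [hc]
      exact and_congr_right fun h => (hv c h).not
    · intro c h
      rw [hs c h.1, if_neg fun hf => h.2 (hflip c h.1 hf)]
    · intro c d _ _ _
      rw [hw', alternate_map f.injective]
  | omega1 x b w hv hs hD hE =>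
    refine reidemeisterEquivalent_of_kink (x := x) (w := w.map Prod.fst) hv hs ?_ ?_
    · rw [chordWord, hD]; rfl
    · rw [chordWord, hE]
  | omega2 x y b second w₁ w₂ hv hs hkind hsign hsecond hD hE =>
    refine reidemeisterEquivalent_of_bigon (x := x) (y := y) (second := second.map Prod.fst)
      (w₁ := w₁.map Prod.fst) (w₂ := w₂.map Prod.fst) hv hs hkind hsign ?_ ?_ ?_
    · rcases hsecond with rfl | rfl
      exacts [Or.inl rfl, Or.inr rfl]
    · rw [chordWord, hD]; simp
    · rw [chordWord, hE]; simp
  | omega3 x y z t s₁ s₂ s₃ w₁ w₂ w₃ hv hs hkind hx hy hz hword =>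
    rcases hword with ⟨hD, hE⟩ | ⟨hD, hE⟩
    · refine reidemeisterEquivalent_of_triangle (w₁ := w₁.map Prod.fst) (w₂ := w₂.map Prod.fst)
        (w₃ := w₃.map Prod.fst) hv hs hkind hx hy hz ?_ ?_
      · simp only [chordWord, hD, List.map_append, map_fst_strand, triangleWord]
      · simp only [chordWord, hE, List.map_append, map_fst_strand, triangleWord]
    · -- If strand `3` is met before strand `2`, exchange their roles, and thereby those of `x`
      -- and `y`; all strands are then read in the opposite direction.
      refine reidemeisterEquivalent_of_triangle (x := y) (y := x) (z := z) (a := -t) (b := t)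
        (s₁ := -s₁) (s₂ := -s₃) (s₃ := -s₂) (w₁ := w₁.map Prod.fst) (w₂ := w₂.map Prod.fst)
        (w₃ := w₃.map Prod.fst) hv hs (by tauto) ?_ ?_ ?_ ?_ ?_
      · rw [hy]; simp
      · rw [hx]; simp
      · rw [hz]; simp [mul_right_comm]
      · simp only [chordWord, hD, List.map_append, map_fst_strand, triangleWord, strandLetters_neg]
      · simp only [chordWord, hE, List.map_append, map_fst_strand, triangleWord, strandLetters_neg]

end KnotDiagram

/-! ### Maps on quotients -/

theorem eqvGen_of_forall {α β : Type*} {r : α → α → Prop} {s : β → β → Prop} {f : α → β}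
    (h : ∀ a b, r a b → Relation.EqvGen s (f a) (f b)) {a b : α} (hab : Relation.EqvGen r a b) :
    Relation.EqvGen s (f a) (f b) := by
  induction hab with
  | rel a b hab => exact h a b hab
  | refl a => exact .refl _
  | symm a b _ ih => exact .symm _ _ ih
  | trans a b c _ _ ih₁ ih₂ => exact .trans _ _ _ ih₁ ih₂

theorem existsUnique_quotient_map {α β : Type*} {r : Setoid α} {s : Setoid β} {f : α → β}
    (h : ∀ a b, r a b → s (f a) (f b)) :
    ∃! Λ : Quotient r → Quotient s, ∀ a, Λ (Quotient.mk r a) = Quotient.mk s (f a) := by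
  refine ⟨Quotient.map f fun a b hab => h a b hab, fun a => rfl, fun Λ hΛ => ?_⟩
  funext q
  induction q using Quotient.ind with
  | _ a => exact hΛ a

theorem theorem2 :
    (∀ D₁ D₂ : ClassicalDiagram, ClassicalDiagram.SameClassicalKnot D₁ D₂ →
      LoopedGraph.ReidemeisterEquivalent
        D₁.1.loopedInterlacementGraph D₂.1.loopedInterlacementGraph) ∧
    (∀ D₁ D₂ : KnotDiagram, KnotDiagram.SameVirtualKnot D₁ D₂ →
      LoopedGraph.ReidemeisterEquivalent
        D₁.loopedInterlacementGraph D₂.loopedInterlacementGraph) ∧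
    (∃! Λ : ClassicalKnot → LoopedGraph.ReidemeisterClass, ∀ D : ClassicalDiagram,
      Λ (Quotient.mk ClassicalDiagram.classicalSetoid D) =
        Quotient.mk LoopedGraph.reidemeisterSetoid D.1.loopedInterlacementGraph) ∧
    (∃! Λ : VirtualKnot → LoopedGraph.ReidemeisterClass, ∀ D : KnotDiagram,
      Λ (Quotient.mk KnotDiagram.virtualSetoid D) =
        Quotient.mk LoopedGraph.reidemeisterSetoid D.loopedInterlacementGraph) := by
  have hc : ∀ D₁ D₂ : ClassicalDiagram, ClassicalDiagram.SameClassicalKnot D₁ D₂ →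
      LoopedGraph.ReidemeisterEquivalent
        D₁.1.loopedInterlacementGraph D₂.1.loopedInterlacementGraph := fun _ _ h =>
    eqvGen_of_forall (f := fun D : ClassicalDiagram => D.1.loopedInterlacementGraph)
      (fun _ _ h => KnotDiagram.Move.reidemeisterEquivalent h) h
  have hv : ∀ D₁ D₂ : KnotDiagram, KnotDiagram.SameVirtualKnot D₁ D₂ →
      LoopedGraph.ReidemeisterEquivalent
        D₁.loopedInterlacementGraph D₂.loopedInterlacementGraph := fun _ _ h =>
    eqvGen_of_forall (fun _ _ h => KnotDiagram.Move.reidemeisterEquivalent h) h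
  exact ⟨hc, hv, existsUnique_quotient_map hc, existsUnique_quotient_map hv⟩
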